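/- Setting. A self-dual CSS code $\mathcal Q$ on $n$ qubits encoding $k\ge 1$ logical qubits is the stabilizer code whose stabilizer group is generated by the $X$-type and the $Z$-type Pauli operators given by the rows of one and the same binary parity check matrix $H$, with $HH^{T}=0$ and $n-k=2\,\mathrm{rank}\,H$. A symplectic basis $\{(\bar X_j,\bar Z_j)\}_{j\in[k]}$ of $\mathcal Q$ consists of physical Pauli operators commuting with all stabilizers, with $\bar X_j^2=\bar Z_j^2=I$, that satisfy the commutation relations of the operators $X_j,Z_j$ on $k$ qubits and, together with the stabilizers and $iI$, generate the centralizer of the stabilizer group in the Pauli group; it defines the logical qubits of $\mathcal Q$. It is called compatible if, as operations on the code space (up to a global phase), (i) $\bigotimes_{j=1}^{k}\bar H_j=\bigotimes_{i=1}^{n}H_i$, and (ii) for every $(a_j)\in\{1,-1\}^k$ there is $(b_i)\in\{1,-1\}^n$ with $\bigotimes_{j=1}^{k}\bar S_j^{a_j}=\bigotimes_{i=1}^{n}S_i^{b_i}$. Let $\mathcal Q_1,\dots,\mathcal Q_L$ be self-dual CSS codes, $\mathcal Q_i$ encoding $k_i\ge1$ logical qubits into $n_i$ qubits. In the concatenated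 code $\mathcal Q_L\circ\cdots\circ\mathcal Q_1$, the logical qubits at level $l\in\{0,\dots,L\}$ are labelled by $(j_1,\dots,j_l,i_{l+1},\dots,i_L)\in[k_1]\times\cdots\times[k_l]\times[n_{l+1}]\times\cdots\times[n_L]$; level $0$ consists of the physical qubits, and for each choice of the other coordinates $\mathcal Q_l$ encodes the $n_l$ logical qubits $(j_1,\dots,j_{l-1},i_l,i_{l+1},\dots,i_L)$, $i_l\in[n_l]$, at level $l-1$ into the $k_l$ logical qubits $(j_1,\dots,j_{l-1},j_l,i_{l+1},\dots,i_L)$, $j_l\in[k_l]$, at level $l$. A gate on the logical qubits at level $l$ is transversal at level $m\le l$ if, as an operation on the states encoded from level $l$, it equals a tensor product of single-qubit unitary gates, one on each logical qubit at level $m$. Theorem. Suppose that the logical operators of each $\mathcal Q_i$, $i\in[L]$, are defined by a compatible symplectic basis of $\mathcal Q_i$. Let $l\in\{0,\dots,L\}$, $B_1\subseteq[k_1],\dots,B_l\subseteq[k_l]$, $A_{l+1}\subseteq[n_{l+1}],\dots,A_L\subseteq[n_L]$, and let $U$ be a gate that applies $X$, $Y$ or $Z$ (possibly different ones on different qubits)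 to each logical qubit at level $l$ with label in $B_1\times\cdots\times B_l\times A_{l+1}\times\cdots\times A_L$ and the identity to every other logical qubit at level $l$. Then $U$ is transversal at each of the levels $0,1,\dots,l$. -/

import Mathlib

open scoped Matrix

noncomputable section

/-! ### Qubits, tensor products and Pauli operators

The pure states of a register of qubits labelled by a finite type `ι` are the vectors indexed by
the bit strings `ι → Fin 2`, and the operators on it are the square matrices indexed by them. -/

/-- Operators on the register of qubits labelled by `ι`. -/
abbrev QOp (ι : Type) : Type := Matrix (ι → Fin 2) (ι → Fin 2) ℂ

/-- The tensor product `⨂ q, G q` of single-qubit operators. -/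
def tensorOp {ι : Type} [Fintype ι] (G : ι → Matrix (Fin 2) (Fin 2) ℂ) : QOp ι :=
  Matrix.of fun x y => ∏ q, G q (x q) (y q)

def pauliX : Matrix (Fin 2) (Fin 2) ℂ := !![0, 1; 1, 0]

def pauliY : Matrix (Fin 2) (Fin 2) ℂ := !![0, -Complex.I; Complex.I, 0]

def pauliZ : Matrix (Fin 2) (Fin 2) ℂ := !![1, 0; 0, -1]

/-- The Hadamard gate. -/
def hadamardGate : Matrix (Fin 2) (Fin 2) ℂ :=
  ((Real.sqrt 2 : ℝ) : ℂ)⁻¹ • !![1, 1; 1, -1]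

/-- The gate `S ^ a` for a sign `a = 1` or `a = -1`: it is `S = diag (1, i)` for `a = 1` and
`S† = S⁻¹ = diag (1, -i)` for `a = -1`. -/
def phaseGate (a : ℤˣ) : Matrix (Fin 2) (Fin 2) ℂ :=
  !![1, 0; 0, ((a : ℤ) : ℂ) * Complex.I]

/-- Elements of the Pauli group: a phase `1, i, -1, -i` times a tensor product of the
single-qubit operators `I, X, Y, Z`. -/
def IsPauli {ι : Type} [Fintype ι] (M : QOp ι) : Prop :=
  ∃ (c : ℕ) (P : ι → Matrix (Fin 2) (Fin 2) ℂ),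
    (∀ q, P q = 1 ∨ P q = pauliX ∨ P q = pauliY ∨ P q = pauliZ) ∧
      M = Complex.I ^ c • tensorOp P

/-- The operator acting as `P` on qubit `j` and as the identity on the others. -/
def onQubit {ι : Type} [Fintype ι] [DecidableEq ι] (j : ι) (P : Matrix (Fin 2) (Fin 2) ℂ) :
    QOp ι :=
  tensorOp fun q => if q = j then P else 1

/-- The operator acting as `P` on the qubits in the support of the binary vector `v` and as the
identity on the others. -/
def onSupport {ι : Type} [Fintype ι] (v : ι → ZMod 2) (P : Matrix (Fin 2) (Fin 2) ℂ) : QOp ι :=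
  tensorOp fun q => if v q = 1 then P else 1

/-! ### Self-dual CSS codes and symplectic bases -/

/-- A self-dual CSS code on `n` physical qubits with `k` logical qubits: one binary parity check
matrix `H` serves both for the `X`-type and for the `Z`-type stabilizer generators. The generators
commute because `H * Hᵀ = 0`, and there are `n - k` independent ones. -/
structure SelfDualCSSCode (n k : ℕ) where
  r : ℕ
  H : Matrix (Fin r) (Fin n) (ZMod 2)
  selfOrthogonal : H * Hᵀ = 0
  rank_eq : 2 * H.rank + k = n

namespace SelfDualCSSCode

variable {n k : ℕ} (Q : SelfDualCSSCode n k)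

/-- The stabilizer group, generated by the `X`-type and `Z`-type operators given by the rows of
the parity check matrix. (Generators are of finite order, so that the monoid which they generate
is the group which they generate.) -/
def stabilizer : Submonoid (QOp (Fin n)) :=
  Submonoid.closure
    ((Set.range fun i => onSupport (Q.H i) pauliX) ∪ Set.range fun i => onSupport (Q.H i) pauliZ)

/-- The code space: the simultaneous `+1` eigenspace of all stabilizers. -/
def codeSpace : Submodule ℂ ((Fin n → Fin 2) → ℂ) where
  carrier := {v | ∀ s ∈ Q.stabilizer, s *ᵥ v = v}
  add_mem' := fun {a b} ha hb s hs => by rw [Matrix.mulVec_add, ha s hs, hb s hs]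
  zero_mem' := fun s _ => Matrix.mulVec_zero s
  smul_mem' := fun c v hv s hs => by rw [Matrix.mulVec_smul, hv s hs]

/-- The centralizer `C(S)`: all Pauli operators that commute with all stabilizers. -/
def centralizer : Set (QOp (Fin n)) :=
  {M | IsPauli M ∧ ∀ s ∈ Q.stabilizer, Commute M s}

/-- A symplectic basis of the code: `k` hyperbolic pairs `(X̄_j, Z̄_j)` of physical Pauli operators,
not necessarily of `X`-type and `Z`-type, which satisfy the relations of the Pauli group on `k`
qubits and generate `C(S)` together with the stabilizers and `i`. -/
structure SymplecticBasis where
  X : Fin k → QOp (Fin n)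
  Z : Fin k → QOp (Fin n)
  X_mem : ∀ j, X j ∈ Q.centralizer
  Z_mem : ∀ j, Z j ∈ Q.centralizer
  X_sq : ∀ j, X j * X j = 1
  Z_sq : ∀ j, Z j * Z j = 1
  X_comm : ∀ j j', Commute (X j) (X j')
  Z_comm : ∀ j j', Commute (Z j) (Z j')
  X_Z_comm : ∀ j j', j ≠ j' → Commute (X j) (Z j')
  X_Z_anticomm : ∀ j, X j * Z j + Z j * X j = 0
  generate : (Submonoid.closure ((Q.stabilizer : Set (QOp (Fin n))) ∪ {Complex.I • 1} ∪
    Set.range X ∪ Set.range Z) : Set (QOp (Fin n))) = Q.centralizer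

/-- `V` is an encoding map for the symplectic basis: an isometry from the space of `k` qubits onto
the code space under which `X_j` and `Z_j` correspond to the logical operators `X̄_j` and `Z̄_j`.
Such a map is unique up to a global phase. -/
structure IsEncoder (𝓑 : Q.SymplecticBasis) (V : Matrix (Fin n → Fin 2) (Fin k → Fin 2) ℂ) :
    Prop where
  isometry : Vᴴ * V = 1
  range_eq : LinearMap.range V.mulVecLin = Q.codeSpace
  X_intertwine : ∀ j, 𝓑.X j * V = V * onQubit j pauliX
  Z_intertwine : ∀ j, 𝓑.Z j * V = V * onQubit j pauliZ

end SelfDualCSSCode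

/-! ### Existence of the encoding map -/

theorem tensorOp_mul {ι : Type} [Fintype ι] [DecidableEq ι]
    (A B : ι → Matrix (Fin 2) (Fin 2) ℂ) :
    tensorOp A * tensorOp B = tensorOp fun q => A q * B q := by
  ext x y
  simp only [tensorOp, Matrix.mul_apply, Matrix.of_apply, ← Finset.prod_mul_distrib]
  rw [Finset.prod_univ_sum, Fintype.piFinset_univ]

theorem tensorOp_one {ι : Type} [Fintype ι] [DecidableEq ι] :
    tensorOp (fun _ : ι => (1 : Matrix (Fin 2) (Fin 2) ℂ)) = 1 := by
  ext x y
  simp only [tensorOp, Matrix.of_apply, Matrix.one_apply]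
  by_cases h : x = y
  · simp [h]
  · obtain ⟨q, hq⟩ := Function.ne_iff.mp h
    rw [if_neg h]
    exact Finset.prod_eq_zero (Finset.mem_univ q) (if_neg hq)

theorem IsPauli.conjTranspose_mul {ι : Type} [Fintype ι] [DecidableEq ι] {M : QOp ι}
    (h : IsPauli M) : Mᴴ * M = 1 := by
  obtain ⟨c, P, hP, rfl⟩ := h
  have h1 : (tensorOp P)ᴴ = tensorOp fun q => (P q)ᴴ := by
    ext x y
    simp [tensorOp, Matrix.conjTranspose_apply]
  have h2 : ∀ q, (P q)ᴴ * P q = 1 := by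
    intro q
    rcases hP q with h | h | h | h <;> rw [h] <;> ext i j <;> fin_cases i <;> fin_cases j <;>
      simp [pauliX, pauliY, pauliZ, Matrix.mul_apply, Fin.sum_univ_two, Matrix.conjTranspose_apply]
  rw [Matrix.conjTranspose_smul, Matrix.smul_mul, Matrix.mul_smul, smul_smul, h1, tensorOp_mul]
  simp only [h2, tensorOp_one]
  have : star (Complex.I ^ c) * Complex.I ^ c = 1 := by
    rw [star_pow, ← mul_pow]; simp
  rw [this, one_smul]

theorem zmod_two_cases : ∀ c : ZMod 2, c = 0 ∨ c = 1 := by decide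

/-- The sign `(-1) ^ c` of a bit. -/
def bitSign (c : ZMod 2) : ℂ := if c = 0 then 1 else -1

theorem bitSign_add (a b : ZMod 2) : bitSign (a + b) = bitSign a * bitSign b := by
  have h11 : (1 : ZMod 2) + 1 = 0 := by decide
  rcases zmod_two_cases a with rfl | rfl <;> rcases zmod_two_cases b with rfl | rfl <;>
    simp [bitSign, h11]

theorem bitSign_sum {ι : Type} [DecidableEq ι] (s : Finset ι) (f : ι → ZMod 2) :
    bitSign (∑ q ∈ s, f q) = ∏ q ∈ s, bitSign (f q) := by
  induction s using Finset.induction_on with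
  | empty => simp [bitSign]
  | insert a s ha ih => rw [Finset.sum_insert ha, Finset.prod_insert ha, bitSign_add, ih]

theorem onSupport_X_apply {n : ℕ} (v x y : Fin n → ZMod 2) :
    (onSupport v pauliX : QOp (Fin n)) x y = if y = x + v then 1 else 0 := by
  have key : ∀ a b c : ZMod 2,
      (if c = 1 then pauliX else 1) a b = if b = a + c then (1 : ℂ) else 0 := by
    intro a b c
    fin_cases a <;> fin_cases b <;> fin_cases c <;> rfl
  have h : (onSupport v pauliX : QOp (Fin n)) x y =
      ∏ q, if y q = x q + v q then (1 : ℂ) else 0 := by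
    change (∏ q : Fin n, (if v q = 1 then pauliX else 1) (x q) (y q)) = _
    exact Finset.prod_congr rfl fun q _ => key (x q) (y q) (v q)
  rw [h]
  split_ifs with hy
  · exact Finset.prod_eq_one fun q _ => if_pos (congrFun hy q)
  · obtain ⟨q, hq⟩ := Function.ne_iff.mp hy
    exact Finset.prod_eq_zero (Finset.mem_univ q) (if_neg hq)

theorem onSupport_Z_apply {n : ℕ} (v x y : Fin n → ZMod 2) :
    (onSupport v pauliZ : QOp (Fin n)) x y = if y = x then bitSign (v ⬝ᵥ x) else 0 := by
  have key : ∀ a b c : ZMod 2,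
      (if c = 1 then pauliZ else 1) a b = if b = a then bitSign (c * a) else 0 := by
    intro a b c
    fin_cases a <;> fin_cases b <;> fin_cases c <;> rfl
  have h : (onSupport v pauliZ : QOp (Fin n)) x y =
      ∏ q, if y q = x q then bitSign (v q * x q) else 0 := by
    change (∏ q : Fin n, (if v q = 1 then pauliZ else 1) (x q) (y q)) = _
    exact Finset.prod_congr rfl fun q _ => key (x q) (y q) (v q)
  rw [h, dotProduct, bitSign_sum]
  split_ifs with hy
  · exact Finset.prod_congr rfl fun q _ => if_pos (congrFun hy q)
  · obtain ⟨q, hq⟩ := Function.ne_iff.mp hy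
    exact Finset.prod_eq_zero (Finset.mem_univ q) (if_neg hq)

theorem onSupport_X_mulVec {n : ℕ} (v x : Fin n → ZMod 2) (w : (Fin n → ZMod 2) → ℂ) :
    ((onSupport v pauliX : QOp (Fin n)) *ᵥ w) x = w (x + v) := by
  have h : ((onSupport v pauliX : QOp (Fin n)) *ᵥ w) x =
      ∑ y : Fin n → ZMod 2, (if y = x + v then (1 : ℂ) else 0) * w y :=
    Finset.sum_congr rfl fun y _ => congrArg (· * w y) (onSupport_X_apply v x y)
  rw [h]
  simp

theorem onSupport_Z_mulVec {n : ℕ} (v x : Fin n → ZMod 2) (w : (Fin n → ZMod 2) → ℂ) :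
    ((onSupport v pauliZ : QOp (Fin n)) *ᵥ w) x = bitSign (v ⬝ᵥ x) * w x := by
  have h : ((onSupport v pauliZ : QOp (Fin n)) *ᵥ w) x =
      ∑ y : Fin n → ZMod 2, (if y = x then bitSign (v ⬝ᵥ x) else 0) * w y :=
    Finset.sum_congr rfl fun y _ => congrArg (· * w y) (onSupport_Z_apply v x y)
  rw [h]
  simp

theorem onQubit_eq_onSupport {k : ℕ} (j : Fin k) (P : Matrix (Fin 2) (Fin 2) ℂ) :
    onQubit j P = onSupport (Pi.single j 1) P := by
  unfold onQubit onSupport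
  congr 1
  funext q
  by_cases h : q = j
  · subst h; simp
  · simp [h]

theorem eq_add_single_iff {k : ℕ} (m y : Fin k → ZMod 2) (j : Fin k) :
    m = y + Pi.single j 1 ↔ y = m + Pi.single j 1 := by
  have h2 : (Pi.single j 1 + Pi.single j 1 : Fin k → ZMod 2) = 0 := by
    rw [← Pi.single_add, show (1 : ZMod 2) + 1 = 0 by decide, Pi.single_zero]
  constructor <;> rintro rfl <;> rw [add_assoc, h2, add_zero]

theorem add_single_same {k : ℕ} (m : Fin k → ZMod 2) (j : Fin k) :
    (m + Pi.single j 1 : Fin k → ZMod 2) j = m j + 1 := by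
  rw [Pi.add_apply, Pi.single_eq_same]

theorem add_single_of_ne {k : ℕ} (m : Fin k → ZMod 2) {i j : Fin k} (h : i ≠ j) :
    (m + Pi.single j 1 : Fin k → ZMod 2) i = m i := by
  rw [Pi.add_apply, Pi.single_eq_of_ne h, add_zero]

namespace SelfDualCSSCode

variable {n k : ℕ} (Q : SelfDualCSSCode n k)

theorem mem_codeSpace_iff (w : (Fin n → ZMod 2) → ℂ) :
    w ∈ Q.codeSpace ↔ (∀ i x, w (x + Q.H i) = w x) ∧ ∀ i x, Q.H i ⬝ᵥ x ≠ 0 → w x = 0 := by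
  have hZ : ∀ i, (onSupport (Q.H i) pauliZ : QOp (Fin n)) *ᵥ w = w ↔
      ∀ x, Q.H i ⬝ᵥ x ≠ 0 → w x = 0 := by
    intro i
    constructor
    · intro h x hx
      have h1 := (onSupport_Z_mulVec (Q.H i) x w).symm.trans (congrFun h x)
      rw [bitSign, if_neg hx] at h1
      linear_combination (-1 / 2 : ℂ) * h1
    · intro h
      funext (x : Fin n → ZMod 2)
      refine (onSupport_Z_mulVec (Q.H i) x w).trans ?_
      rw [bitSign]
      split_ifs with hx
      · rw [one_mul]
      · rw [h x hx, mul_zero]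
  have hX : ∀ i, (onSupport (Q.H i) pauliX : QOp (Fin n)) *ᵥ w = w ↔
      ∀ x, w (x + Q.H i) = w x := by
    intro i
    constructor
    · intro h x
      exact (onSupport_X_mulVec (Q.H i) x w).symm.trans (congrFun h x)
    · intro h
      funext (x : Fin n → ZMod 2)
      exact (onSupport_X_mulVec (Q.H i) x w).trans (h x)
  constructor
  · intro h
    exact ⟨fun i => (hX i).1 (h _ (Submonoid.subset_closure (Or.inl ⟨i, rfl⟩))),
      fun i => (hZ i).1 (h _ (Submonoid.subset_closure (Or.inr ⟨i, rfl⟩)))⟩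
  · rintro ⟨h1, h2⟩ s hs
    induction hs using Submonoid.closure_induction with
    | mem s hs =>
      rcases hs with ⟨i, rfl⟩ | ⟨i, rfl⟩
      · exact (hX i).2 (h1 i)
      · exact (hZ i).2 (h2 i)
    | one => exact Matrix.one_mulVec w
    | mul s t _ _ hs ht =>
      exact (Matrix.mulVec_mulVec _ _ _).symm.trans ((congrArg (s *ᵥ ·) ht).trans hs)

/-- The binary code generated by the rows of the parity check matrix. -/
def rowCode : Submodule (ZMod 2) (Fin n → ZMod 2) := Submodule.span (ZMod 2) (Set.range Q.H)

/-- The binary code with the given parity check matrix. -/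
def checkCode : Submodule (ZMod 2) (Fin n → ZMod 2) := LinearMap.ker Q.H.mulVecLin

theorem mem_checkCode (x : Fin n → ZMod 2) : x ∈ Q.checkCode ↔ ∀ i, Q.H i ⬝ᵥ x = 0 := by
  rw [checkCode, LinearMap.mem_ker, Matrix.mulVecLin_apply, funext_iff]
  rfl

theorem rowCode_le : Q.rowCode ≤ Q.checkCode := by
  refine Submodule.span_le.2 ?_
  rintro _ ⟨j, rfl⟩
  rw [SetLike.mem_coe, mem_checkCode]
  intro i
  exact congrFun (congrFun Q.selfOrthogonal i) j

theorem apply_add_of_mem {w : (Fin n → ZMod 2) → ℂ} (hw : w ∈ Q.codeSpace)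
    {g : Fin n → ZMod 2} (hg : g ∈ Q.rowCode) (x : Fin n → ZMod 2) : w (x + g) = w x := by
  have h := ((Q.mem_codeSpace_iff w).1 hw).1
  induction hg using Submodule.span_induction generalizing x with
  | mem g hg => obtain ⟨i, rfl⟩ := hg; exact h i x
  | zero => rw [add_zero]
  | add a b _ _ ha hb => rw [← add_assoc, hb, ha]
  | smul c a _ ha => rcases zmod_two_cases c with rfl | rfl <;> simp [ha]

theorem finrank_quotient :
    Module.finrank (ZMod 2) (Q.checkCode ⧸ Q.rowCode.submoduleOf Q.checkCode) = k := by
  have h1 := (Q.rowCode.submoduleOf Q.checkCode).finrank_quotient_add_finrank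
  rw [(Submodule.submoduleOfEquivOfLe Q.rowCode_le).finrank_eq] at h1
  have h2 : Module.finrank (ZMod 2) Q.rowCode = Q.H.rank := Q.H.rank_eq_finrank_span_row.symm
  have h3 := LinearMap.finrank_range_add_finrank_ker Q.H.mulVecLin
  rw [Module.finrank_fin_fun] at h3
  change Q.H.rank + Module.finrank (ZMod 2) Q.checkCode = n at h3
  have h4 := Q.rank_eq
  omega

theorem finrank_codeSpace_le : Module.finrank ℂ Q.codeSpace ≤ 2 ^ k := by
  classical
  let W := Q.checkCode ⧸ Q.rowCode.submoduleOf Q.checkCode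
  have : Fintype W := Fintype.ofFinite W
  have hcard : Fintype.card W = 2 ^ k := by
    rw [Module.card_eq_pow_finrank (K := ZMod 2), Q.finrank_quotient, ZMod.card]
  let f : Q.codeSpace →ₗ[ℂ] (W → ℂ) :=
    { toFun := fun w c => w.1 (Quotient.out c : Q.checkCode).1
      map_add' := fun _ _ => rfl
      map_smul' := fun _ _ => rfl }
  have hf : Function.Injective f := by
    rw [← LinearMap.ker_eq_bot, LinearMap.ker_eq_bot']
    rintro ⟨w, hw⟩ h0
    apply Subtype.ext
    funext (x : Fin n → ZMod 2)
    change w x = 0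
    by_cases hx : x ∈ Q.checkCode
    · let c : W := Submodule.Quotient.mk ⟨x, hx⟩
      have h1 : w (Quotient.out c : Q.checkCode).1 = 0 := congrFun h0 c
      have h2 : (Submodule.Quotient.mk (Quotient.out c) : W) = Submodule.Quotient.mk ⟨x, hx⟩ :=
        Quotient.out_eq c
      rw [Submodule.Quotient.eq] at h2
      have h3 : (Quotient.out c : Q.checkCode).1 - x ∈ Q.rowCode := h2
      have h4 := Q.apply_add_of_mem hw h3 x
      rw [add_sub_cancel] at h4
      exact h4 ▸ h1
    · rw [mem_checkCode] at hx
      push Not at hx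
      obtain ⟨i, hi⟩ := hx
      exact ((Q.mem_codeSpace_iff w).1 hw).2 i x hi
  calc Module.finrank ℂ Q.codeSpace ≤ Module.finrank ℂ (W → ℂ) :=
        LinearMap.finrank_le_finrank_of_injective hf
    _ = 2 ^ k := by rw [Module.finrank_fintype_fun_eq_card, hcard]

theorem exists_ne_zero : ∃ w ∈ Q.codeSpace, w ≠ 0 := by
  classical
  refine ⟨fun x : Fin n → ZMod 2 => if x ∈ Q.rowCode then (1 : ℂ) else 0,
    (Q.mem_codeSpace_iff _).2 ⟨?_, ?_⟩, ?_⟩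
  · intro i x
    have hi : Q.H i ∈ Q.rowCode := Submodule.subset_span ⟨i, rfl⟩
    simp only [Submodule.add_mem_iff_left _ hi]
  · intro i x hx
    exact if_neg fun h => hx ((Q.mem_checkCode x).1 (Q.rowCode_le h) i)
  · intro h
    have h0 := congrFun h (0 : Fin n → ZMod 2)
    exact one_ne_zero ((if_pos Q.rowCode.zero_mem).symm.trans h0)

theorem mulVec_mem_codeSpace {M : QOp (Fin n)} (hM : M ∈ Q.centralizer)
    {w : (Fin n → Fin 2) → ℂ} (hw : w ∈ Q.codeSpace) : M *ᵥ w ∈ Q.codeSpace := by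
  intro s hs
  rw [Matrix.mulVec_mulVec, ← (hM.2 s hs).eq, ← Matrix.mulVec_mulVec, hw s hs]

variable {Q} (𝓑 : Q.SymplecticBasis)

namespace SymplecticBasis

/-- There is a nonzero code state fixed by all logical `Z` operators. -/
theorem exists_zero_state :
    ∃ w ∈ Q.codeSpace, w ≠ 0 ∧ ∀ j, 𝓑.Z j *ᵥ w = w := by
  suffices h : ∀ s : Finset (Fin k), ∃ w ∈ Q.codeSpace, w ≠ 0 ∧ ∀ j ∈ s, 𝓑.Z j *ᵥ w = w by
    obtain ⟨w, h1, h2, h3⟩ := h Finset.univ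
    exact ⟨w, h1, h2, fun j => h3 j (Finset.mem_univ j)⟩
  intro s
  induction s using Finset.induction_on with
  | empty =>
    obtain ⟨w, h1, h2⟩ := Q.exists_ne_zero
    exact ⟨w, h1, h2, by simp⟩
  | insert j s hj ih =>
    obtain ⟨w, h1, h2, h3⟩ := ih
    by_cases h : w + 𝓑.Z j *ᵥ w = 0
    · have hneg : 𝓑.Z j *ᵥ w = -w := eq_neg_of_add_eq_zero_right h
      refine ⟨𝓑.X j *ᵥ w, Q.mulVec_mem_codeSpace (𝓑.X_mem j) h1, ?_, ?_⟩
      · intro h0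
        apply h2
        rw [← Matrix.one_mulVec w, ← 𝓑.X_sq j, ← Matrix.mulVec_mulVec, h0, Matrix.mulVec_zero]
      · intro i hi
        rcases Finset.mem_insert.1 hi with rfl | hi
        · rw [Matrix.mulVec_mulVec, eq_neg_of_add_eq_zero_right (𝓑.X_Z_anticomm i),
            Matrix.neg_mulVec, ← Matrix.mulVec_mulVec, hneg, Matrix.mulVec_neg, neg_neg]
        · have hne : j ≠ i := fun e => hj (e ▸ hi)
          rw [Matrix.mulVec_mulVec, ← (𝓑.X_Z_comm j i hne).eq, ← Matrix.mulVec_mulVec, h3 i hi]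
    · refine ⟨_, Q.codeSpace.add_mem h1 (Q.mulVec_mem_codeSpace (𝓑.Z_mem j) h1), h, ?_⟩
      intro i hi
      rcases Finset.mem_insert.1 hi with rfl | hi
      · rw [Matrix.mulVec_add, Matrix.mulVec_mulVec, 𝓑.Z_sq, Matrix.one_mulVec, add_comm]
      · rw [Matrix.mulVec_add, Matrix.mulVec_mulVec, (𝓑.Z_comm i j).eq, ← Matrix.mulVec_mulVec,
          h3 i hi]

/-- The product of the operators `X̄_j` with `m j = 1`. -/
def flip (m : Fin k → Fin 2) : QOp (Fin n) :=
  Finset.univ.noncommProd (fun j => 𝓑.X j ^ (m j).val)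
    fun i _ j _ _ => (𝓑.X_comm i j).pow_pow _ _

theorem flip_split (m : Fin k → Fin 2) (j : Fin k) :
    ∃ R : QOp (Fin n), (∀ M, (∀ i, i ≠ j → Commute M (𝓑.X i)) → Commute M R) ∧
      ∀ m' : Fin k → Fin 2, (∀ i, i ≠ j → m' i = m i) →
        𝓑.flip m' = 𝓑.X j ^ (m' j).val * R := by
  refine ⟨(Finset.univ.erase j).noncommProd (fun i => 𝓑.X i ^ (m i).val)
    fun i _ j _ _ => (𝓑.X_comm i j).pow_pow _ _, ?_, ?_⟩
  · intro M hM
    exact Finset.noncommProd_commute _ _ _ _ fun i hi =>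
      (hM i (Finset.ne_of_mem_erase hi)).pow_right _
  · intro m' hm'
    have h1 : (Finset.univ : Finset (Fin k)) = insert j (Finset.univ.erase j) :=
      (Finset.insert_erase (Finset.mem_univ j)).symm
    refine (Finset.noncommProd_congr h1 (fun _ _ => rfl) _).trans ?_
    refine (Finset.noncommProd_insert_of_notMem _ _ _ _ (Finset.notMem_erase j _)).trans ?_
    congr 1
    exact Finset.noncommProd_congr rfl
      (fun i hi => by rw [hm' i (Finset.ne_of_mem_erase hi)]) _

theorem X_mul_flip (m m' : Fin k → Fin 2) (j : Fin k) (hj : m' j = m j + 1)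
    (h : ∀ i, i ≠ j → m' i = m i) : 𝓑.X j * 𝓑.flip m = 𝓑.flip m' := by
  obtain ⟨R, -, hR⟩ := 𝓑.flip_split m j
  rw [hR m fun _ _ => rfl, hR m' h, ← mul_assoc, hj]
  congr 1
  generalize m j = c
  fin_cases c <;> simp [𝓑.X_sq]

theorem Z_mulVec_flip (m : Fin k → Fin 2) (j : Fin k) {w : (Fin n → Fin 2) → ℂ}
    (hw : 𝓑.Z j *ᵥ w = w) :
    𝓑.Z j *ᵥ (𝓑.flip m *ᵥ w) = bitSign (m j) • (𝓑.flip m *ᵥ w) := by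
  obtain ⟨R, hcomm, hR⟩ := 𝓑.flip_split m j
  have hZR : Commute (𝓑.Z j) R := hcomm _ fun i hi => (𝓑.X_Z_comm i j hi).symm
  rw [hR m fun _ _ => rfl]
  have hc : ∀ c : Fin 2, 𝓑.Z j * 𝓑.X j ^ c.val = bitSign c • (𝓑.X j ^ c.val * 𝓑.Z j) := by
    intro c
    fin_cases c
    · have : bitSign ((⟨0, by norm_num⟩ : Fin 2) : ZMod 2) = 1 := rfl
      change _ = bitSign ((⟨0, by norm_num⟩ : Fin 2) : ZMod 2) • _
      rw [this]
      simp
    · have : bitSign ((⟨1, by norm_num⟩ : Fin 2) : ZMod 2) = -1 := rfl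
      change _ = bitSign ((⟨1, by norm_num⟩ : Fin 2) : ZMod 2) • _
      rw [this]
      simp [eq_neg_of_add_eq_zero_right (𝓑.X_Z_anticomm j)]
  rw [Matrix.mulVec_mulVec, ← mul_assoc, hc, Matrix.smul_mul, mul_assoc, hZR.eq, ← mul_assoc,
    Matrix.smul_mulVec, ← Matrix.mulVec_mulVec, hw]

theorem flip_unitary (m : Fin k → Fin 2) : (𝓑.flip m)ᴴ * 𝓑.flip m = 1 := by
  have h : 𝓑.flip m ∈ Matrix.unitaryGroup (Fin n → Fin 2) ℂ :=
    Submonoid.noncommProd_mem _ _ _ _ fun j _ => pow_mem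
      (Matrix.mem_unitaryGroup_iff'.2 (𝓑.X_mem j).1.conjTranspose_mul) _
  exact Matrix.mem_unitaryGroup_iff'.1 h

theorem flip_mem {m : Fin k → Fin 2} {w : (Fin n → Fin 2) → ℂ} (hw : w ∈ Q.codeSpace) :
    𝓑.flip m *ᵥ w ∈ Q.codeSpace := by
  refine Finset.noncommProd_induction _ _ _
    (fun M : QOp (Fin n) => ∀ w ∈ Q.codeSpace, M *ᵥ w ∈ Q.codeSpace) ?_ ?_ ?_ w hw
  · intro a b ha hb w hw
    rw [← Matrix.mulVec_mulVec]
    exact ha _ (hb _ hw)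
  · intro w hw
    rwa [Matrix.one_mulVec]
  · intro j _ w hw
    generalize (m j).val = c
    induction c with
    | zero => rwa [pow_zero, Matrix.one_mulVec]
    | succ c ih =>
      rw [pow_succ', ← Matrix.mulVec_mulVec]
      exact Q.mulVec_mem_codeSpace (𝓑.X_mem j) ih

theorem exists_isEncoder : ∃ V, Q.IsEncoder 𝓑 V := by
  obtain ⟨w, hw, hw0, hwZ⟩ := 𝓑.exists_zero_state
  -- normalize the state
  obtain ⟨v, hv, hv1, hvZ⟩ : ∃ v ∈ Q.codeSpace, star v ⬝ᵥ v = 1 ∧ ∀ j, 𝓑.Z j *ᵥ v = v := by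
    let N : ℝ := ∑ x, ‖w x‖ ^ 2
    have hN : star w ⬝ᵥ w = (N : ℂ) := by
      simp only [dotProduct, Pi.star_apply, N, Complex.ofReal_sum]
      refine Finset.sum_congr rfl fun x _ => ?_
      rw [Complex.star_def, Complex.conj_mul', Complex.ofReal_pow]
    have hpos : 0 < N := by
      obtain ⟨x, hx⟩ := Function.ne_iff.mp hw0
      exact Finset.sum_pos' (fun _ _ => by positivity)
        ⟨x, Finset.mem_univ x, by have := norm_pos_iff.2 hx; positivity⟩
    let c : ℝ := (Real.sqrt N)⁻¹
    refine ⟨(c : ℂ) • w, Q.codeSpace.smul_mem _ hw, ?_, fun j => ?_⟩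
    · rw [star_smul, smul_dotProduct, dotProduct_smul, hN, Complex.star_def, Complex.conj_ofReal,
        smul_eq_mul, smul_eq_mul, ← Complex.ofReal_mul, ← Complex.ofReal_mul]
      have hc : c * (c * N) = 1 := by
        have := Real.mul_self_sqrt hpos.le
        have h2 : Real.sqrt N ≠ 0 := (Real.sqrt_pos.2 hpos).ne'
        simp only [c]
        field_simp
        nlinarith
      rw [hc, Complex.ofReal_one]
    · rw [Matrix.mulVec_smul, hwZ]
  let V : Matrix (Fin n → Fin 2) (Fin k → Fin 2) ℂ := Matrix.of fun x m => (𝓑.flip m *ᵥ v) x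
  have hcol : ∀ (M : QOp (Fin n)) x m, (M * V) x m = (M *ᵥ (𝓑.flip m *ᵥ v)) x :=
    fun _ _ _ => rfl
  have hinner : ∀ m m', (Vᴴ * V) m m' = star (𝓑.flip m *ᵥ v) ⬝ᵥ (𝓑.flip m' *ᵥ v) :=
    fun _ _ => rfl
  have hiso : Vᴴ * V = 1 := by
    ext m m'
    rw [hinner]
    by_cases h : m = m'
    · subst h
      rw [Matrix.one_apply_eq, Matrix.star_mulVec, Matrix.dotProduct_mulVec, Matrix.vecMul_vecMul,
        𝓑.flip_unitary, Matrix.vecMul_one, hv1]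
    · rw [Matrix.one_apply_ne h]
      obtain ⟨j, hj⟩ := Function.ne_iff.mp h
      have hZ : (𝓑.Z j)ᴴ = 𝓑.Z j := by
        calc (𝓑.Z j)ᴴ = (𝓑.Z j)ᴴ * (𝓑.Z j * 𝓑.Z j) := by rw [𝓑.Z_sq, mul_one]
          _ = 𝓑.Z j := by rw [← mul_assoc, (𝓑.Z_mem j).1.conjTranspose_mul, one_mul]
      have e1 := 𝓑.Z_mulVec_flip m j (hvZ j)
      have e2 := 𝓑.Z_mulVec_flip m' j (hvZ j)
      set a := 𝓑.flip m *ᵥ v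
      set b := 𝓑.flip m' *ᵥ v
      have hab : star (𝓑.Z j *ᵥ a) ⬝ᵥ b = star a ⬝ᵥ (𝓑.Z j *ᵥ b) := by
        rw [Matrix.star_mulVec, hZ, Matrix.dotProduct_mulVec (star a)]
      rw [e1, e2, star_smul, smul_dotProduct, dotProduct_smul, smul_eq_mul, smul_eq_mul] at hab
      have hs : (star (bitSign (m j)) - bitSign (m' j)) ≠ 0 := by
        have : ∀ c d : ZMod 2, c ≠ d → star (bitSign c) - bitSign d ≠ 0 := by
          intro c d hcd
          rcases zmod_two_cases c with rfl | rfl <;> rcases zmod_two_cases d with rfl | rfl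
          · exact absurd rfl hcd
          · norm_num [bitSign]
          · norm_num [bitSign]
          · exact absurd rfl hcd
        exact this _ _ hj
      have : (star (bitSign (m j)) - bitSign (m' j)) * (star a ⬝ᵥ b) = 0 := by
        rw [sub_mul, hab, sub_self]
      exact (mul_eq_zero.1 this).resolve_left hs
  have hinj : Function.Injective V.mulVecLin := by
    intro a b hab
    have h1 : V *ᵥ a = V *ᵥ b := hab
    rw [← Matrix.one_mulVec a, ← Matrix.one_mulVec b, ← hiso, ← Matrix.mulVec_mulVec, h1,
      Matrix.mulVec_mulVec]
  have hle : LinearMap.range V.mulVecLin ≤ Q.codeSpace := by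
    rintro _ ⟨a, rfl⟩
    have : V.mulVecLin a = ∑ m, a m • (𝓑.flip m *ᵥ v) := by
      funext x
      simp only [Matrix.mulVecLin_apply, Finset.sum_apply, Pi.smul_apply, smul_eq_mul]
      exact Finset.sum_congr rfl fun m _ => mul_comm _ _
    rw [this]
    exact Submodule.sum_mem _ fun m _ => Q.codeSpace.smul_mem _ (𝓑.flip_mem hv)
  refine ⟨V, hiso, ?_, ?_, ?_⟩
  · refine Submodule.eq_of_le_of_finrank_le hle ?_
    rw [LinearMap.finrank_range_of_inj hinj, Module.finrank_fintype_fun_eq_card]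
    simpa using Q.finrank_codeSpace_le
  · intro j
    ext x m
    let m' : Fin k → ZMod 2 := (m : Fin k → ZMod 2) + Pi.single j 1
    have hm : ∀ y : Fin k → ZMod 2, (onQubit j pauliX : QOp (Fin k)) y m =
        if y = m' then 1 else 0 := by
      intro y
      have hiff : (m : Fin k → ZMod 2) = y + Pi.single j 1 ↔ y = m' := eq_add_single_iff m y j
      rw [onQubit_eq_onSupport]
      refine (onSupport_X_apply (Pi.single j 1) y m).trans ?_
      by_cases e : y = m'
      · rw [if_pos e]
        exact if_pos (hiff.2 e)
      · rw [if_neg e]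
        exact if_neg fun h => e (hiff.1 h)
    have hright : (V * onQubit j pauliX) x m = V x m' := by
      have : (V * onQubit j pauliX) x m =
          ∑ y : Fin k → ZMod 2, V x y * (if y = m' then 1 else 0) :=
        Finset.sum_congr rfl fun y _ => congrArg (V x y * ·) (hm y)
      rw [this]
      simp_rw [mul_ite, mul_one, mul_zero]
      exact (Finset.sum_ite_eq' Finset.univ m' fun y => V x y).trans (if_pos (Finset.mem_univ _))
    rw [hright, hcol, Matrix.mulVec_mulVec, 𝓑.X_mul_flip m m' j]
    · rfl
    · exact add_single_same m j
    · intro i hi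
      exact add_single_of_ne m hi
  · intro j
    ext x m
    let m₀ : Fin k → ZMod 2 := m
    have hm : ∀ y : Fin k → ZMod 2, (onQubit j pauliZ : QOp (Fin k)) y m =
        if y = m₀ then bitSign (m j) else 0 := by
      intro y
      rw [onQubit_eq_onSupport]
      refine (onSupport_Z_apply (Pi.single j 1) y m).trans ?_
      by_cases e : y = m₀
      · rw [if_pos e.symm, if_pos e, e, single_dotProduct, one_mul]
      · rw [if_neg e, if_neg (Ne.symm e)]
    have hright : (V * onQubit j pauliZ) x m = V x m * bitSign (m j) := by
      have : (V * onQubit j pauliZ) x m =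
          ∑ y : Fin k → ZMod 2, V x y * (if y = m₀ then bitSign (m j) else 0) :=
        Finset.sum_congr rfl fun y _ => congrArg (V x y * ·) (hm y)
      rw [this]
      simp_rw [mul_ite, mul_zero]
      exact (Finset.sum_ite_eq' Finset.univ m₀
        fun y => V x y * bitSign (m j)).trans (if_pos (Finset.mem_univ _))
    rw [hright, hcol, 𝓑.Z_mulVec_flip m j (hvZ j), mul_comm]
    rfl

end SymplecticBasis
end SelfDualCSSCode

/-! ### Logical gates of one code block and compatible symplectic bases -/

namespace SelfDualCSSCode.SymplecticBasis

variable {n k : ℕ} {Q : SelfDualCSSCode n k} (𝓑 : Q.SymplecticBasis)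

/-- The encoding map of the code with respect to the symplectic basis. It is determined up to a
global phase, on which nothing below depends. -/
def encoder : Matrix (Fin n → Fin 2) (Fin k → Fin 2) ℂ := 𝓑.exists_isEncoder.choose

theorem isEncoder_encoder : Q.IsEncoder 𝓑 𝓑.encoder := 𝓑.exists_isEncoder.choose_spec

/-- The physical operator `G` acts on the code block as the logical gate `U` on the `k` logical
qubits (up to a global phase). -/
def Implements (G : QOp (Fin n)) (U : QOp (Fin k)) : Prop :=
  ∃ c : ℂ, ‖c‖ = 1 ∧ G * 𝓑.encoder = c • (𝓑.encoder * U)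

/-- The symplectic basis is compatible with multilevel transversal Clifford operations: physical
Hadamard gates on all qubits act as logical Hadamard gates on all logical qubits, and every choice
of `S` or `S†` on each logical qubit is realized by some choice of `S` or `S†` on each physical
qubit. -/
def IsCompatible : Prop :=
  𝓑.Implements (tensorOp fun _ => hadamardGate) (tensorOp fun _ => hadamardGate) ∧
    ∀ a : Fin k → ℤˣ, ∃ b : Fin n → ℤˣ,
      𝓑.Implements (tensorOp fun i => phaseGate (b i)) (tensorOp fun j => phaseGate (a j))

end SelfDualCSSCode.SymplecticBasis

/-! ### Concatenated codes

The codes are numbered from `0`, so that `code i` is the code `Q_{i+1}`, which encodes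
level `i` into level `i + 1`. -/

/-- An `L`-level concatenated code `Q_L ∘ ⋯ ∘ Q_1` of self-dual CSS codes with at least one logical
qubit each, with the symplectic bases that define their logical operators. -/
structure ConcatenatedCode (L : ℕ) where
  n : Fin L → ℕ
  k : Fin L → ℕ
  one_le_k : ∀ i, 1 ≤ k i
  code : ∀ i, SelfDualCSSCode (n i) (k i)
  basis : ∀ i, (code i).SymplecticBasis

namespace ConcatenatedCode

variable {L : ℕ} (𝒞 : ConcatenatedCode L)

/-- The labels `(j_1, …, j_l, i_{l+1}, …, i_L)` of the logical qubits at level `l`, where `j_i`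
ranges over the logical qubits and `i_i` over the physical qubits of the `i`-th code. -/
abbrev LevelIndex (l : ℕ) : Type :=
  (∀ i : {i : Fin L // i.val < l}, Fin (𝒞.k i)) × (∀ i : {i : Fin L // l ≤ i.val}, Fin (𝒞.n i))

/-- The labels of the blocks of the code `l`, which encodes level `l` into level `l + 1`: all
coordinates but the one that belongs to this code. -/
abbrev BlockIndex (l : Fin L) : Type :=
  (∀ i : {i : Fin L // i.val < l.val}, Fin (𝒞.k i)) ×
    (∀ i : {i : Fin L // l.val < i.val}, Fin (𝒞.n i))

/-- The label at level `l` of the physical qubit `a` of the block `b` of the code `l`. -/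
def blockInput (l : Fin L) (b : 𝒞.BlockIndex l) (a : Fin (𝒞.n l)) : 𝒞.LevelIndex l.val :=
  (b.1, fun i =>
    if h : i.1 = l then Fin.cast (congrArg 𝒞.n h.symm) a
    else b.2 ⟨i.1, lt_of_le_of_ne i.2 fun e => h (Fin.ext e.symm)⟩)

/-- The label at level `l + 1` of the logical qubit `c` of the block `b` of the code `l`. -/
def blockOutput (l : Fin L) (b : 𝒞.BlockIndex l) (c : Fin (𝒞.k l)) :
    𝒞.LevelIndex (l.val + 1) :=
  (fun i =>
    if h : i.1 = l then Fin.cast (congrArg 𝒞.k h.symm) c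
    else b.1 ⟨i.1, lt_of_le_of_ne (Nat.lt_succ_iff.1 i.2) fun e => h (Fin.ext e)⟩,
  fun i => b.2 ⟨i.1, i.2⟩)

/-- The encoding of the logical qubits at level `l + 1` into those at level `l`: the tensor
product of the encoding maps of all blocks of the code `l`. -/
def stepEncoder (l : Fin L) :
    Matrix (𝒞.LevelIndex l.val → Fin 2) (𝒞.LevelIndex (l.val + 1) → Fin 2) ℂ :=
  Matrix.of fun x y => ∏ b : 𝒞.BlockIndex l,
    (𝒞.basis l).encoder (fun a => x (𝒞.blockInput l b a)) (fun c => y (𝒞.blockOutput l b c))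

/-- The encoding of the logical qubits at level `l` into those at level `m ≤ l`, the composite of
the encodings of one level into the previous one. For `m = 0` this is the encoding of the inner
code `Q_l ∘ ⋯ ∘ Q_1` (on all its blocks), and for `m = 0` and `l = L` that of the concatenated
code. -/
def levelEncoder {m l : ℕ} (hml : m ≤ l) (hl : l ≤ L) :
    Matrix (𝒞.LevelIndex m → Fin 2) (𝒞.LevelIndex l → Fin 2) ℂ :=
  Nat.leRec
    (motive := fun l _ => l ≤ L → Matrix (𝒞.LevelIndex m → Fin 2) (𝒞.LevelIndex l → Fin 2) ℂ)
    (fun _ => 1)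
    (fun l _ E hl => E (Nat.le_of_succ_le hl) * 𝒞.stepEncoder ⟨l, hl⟩)
    hml hl

/-- A gate `U` on the logical qubits at level `l` is transversal at level `m ≤ l`: on the states
encoded from level `l`, it is a tensor product of single-qubit gates, each of which acts on one
logical qubit at level `m`. -/
def IsTransversalAt {m l : ℕ} (hml : m ≤ l) (hl : l ≤ L) (U : QOp (𝒞.LevelIndex l)) : Prop :=
  ∃ G : 𝒞.LevelIndex m → Matrix (Fin 2) (Fin 2) ℂ,
    (∀ q, G q ∈ Matrix.unitaryGroup (Fin 2) ℂ) ∧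
      tensorOp G * 𝒞.levelEncoder hml hl = 𝒞.levelEncoder hml hl * U

/-- `U` is a Pauli-type transversal gate `U_P(B_1, …, B_l, A_{l+1}, …, A_L)` at level `l`: it
applies `X`, `Y` or `Z` to each logical qubit at level `l` with label in
`B_1 × ⋯ × B_l × A_{l+1} × ⋯ × A_L`, and the identity to the others. -/
def IsPauliTypeGate {l : ℕ} (B : ∀ i : {i : Fin L // i.val < l}, Set (Fin (𝒞.k i)))
    (A : ∀ i : {i : Fin L // l ≤ i.val}, Set (Fin (𝒞.n i))) (U : QOp (𝒞.LevelIndex l)) : Prop :=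
  ∃ P : 𝒞.LevelIndex l → Matrix (Fin 2) (Fin 2) ℂ,
    (∀ q : 𝒞.LevelIndex l, ((∀ i, q.1 i ∈ B i) ∧ ∀ i, q.2 i ∈ A i) →
      P q = pauliX ∨ P q = pauliY ∨ P q = pauliZ) ∧
    (∀ q : 𝒞.LevelIndex l, ¬((∀ i, q.1 i ∈ B i) ∧ ∀ i, q.2 i ∈ A i) → P q = 1) ∧
    U = tensorOp P

end ConcatenatedCode

end

/-! The logical operators $\bar X_j,\bar Z_j$ of a block are themselves Pauli operators, hence
tensor products of single-qubit Paulis up to a phase. So every logical Pauli operator of a block is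
realized by a physical Pauli operator of that block, and the property "tensor product of
single-qubit Paulis with phases" passes from each level to the one below. The factors are unitary,
so this is transversality at every level `m ≤ l`.

The induction runs over all of `pauliTensors`, because the shape $B_1\times\cdots\times A_L$ of the
support need not survive a step. Allowing phases in the single-qubit factors makes this class a
monoid and lets the global phase of a Pauli operator be absorbed by one qubit, so all intertwining
relations are exact equalities.

The one-block statement is `exists_pauliTensors`. The blocks of a code partition the qubits at both
adjacent levels, so the mixed-product rules `tensorOp_mul_blockTensor` and
`blockTensor_mul_tensorOp` extend it to `exists_pauliTensors_stepEncoder`; composing such steps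
gives `exists_pauliTensors_levelEncoder`. -/

/-! ### Tensor products of Pauli operators -/

/-- The single-qubit Pauli group, with phases. -/
def pauliMonoid : Submonoid (Matrix (Fin 2) (Fin 2) ℂ) :=
  Submonoid.closure {pauliX, pauliZ, Complex.I • 1}

theorem pauliX_mem : pauliX ∈ pauliMonoid := Submonoid.subset_closure (by simp)

theorem pauliZ_mem : pauliZ ∈ pauliMonoid := Submonoid.subset_closure (by simp)

theorem I_smul_one_mem : (Complex.I • 1 : Matrix (Fin 2) (Fin 2) ℂ) ∈ pauliMonoid :=
  Submonoid.subset_closure (by simp)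

theorem pauliY_mem : pauliY ∈ pauliMonoid := by
  have h : pauliY = (Complex.I • 1) * (pauliX * pauliZ) := by
    ext i j
    fin_cases i <;> fin_cases j <;> simp [pauliX, pauliY, pauliZ]
  rw [h]
  exact mul_mem I_smul_one_mem (mul_mem pauliX_mem pauliZ_mem)

theorem mem_pauliMonoid {P : Matrix (Fin 2) (Fin 2) ℂ}
    (h : P = 1 ∨ P = pauliX ∨ P = pauliY ∨ P = pauliZ) : P ∈ pauliMonoid := by
  rcases h with rfl | rfl | rfl | rfl
  exacts [one_mem _, pauliX_mem, pauliY_mem, pauliZ_mem]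

theorem pauliMonoid_le_unitaryGroup : pauliMonoid ≤ Matrix.unitaryGroup (Fin 2) ℂ := by
  refine Submonoid.closure_le.2 ?_
  rintro P (rfl | rfl | rfl) <;> rw [SetLike.mem_coe, Matrix.mem_unitaryGroup_iff] <;>
    ext i j <;> fin_cases i <;> fin_cases j <;>
    simp [pauliX, pauliZ, Matrix.mul_apply, Fin.sum_univ_two, Matrix.star_apply]

/-- The tensor products of single-qubit Pauli operators with phases. -/
def pauliTensors (ι : Type) [Fintype ι] [DecidableEq ι] : Submonoid (QOp ι) where
  carrier := {M | ∃ G : ι → Matrix (Fin 2) (Fin 2) ℂ, (∀ q, G q ∈ pauliMonoid) ∧ M = tensorOp G}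
  one_mem' := ⟨fun _ => 1, fun _ => one_mem _, tensorOp_one.symm⟩
  mul_mem' := by
    rintro _ _ ⟨G, hG, rfl⟩ ⟨G', hG', rfl⟩
    exact ⟨fun q => G q * G' q, fun q => mul_mem (hG q) (hG' q), tensorOp_mul G G'⟩

section

variable {ι : Type} [Fintype ι] [DecidableEq ι]

theorem onQubit_mul (j : ι) (P P' : Matrix (Fin 2) (Fin 2) ℂ) :
    onQubit j (P * P') = onQubit j P * onQubit j P' := by
  rw [onQubit, onQubit, onQubit, tensorOp_mul]
  congr 1
  funext q
  split_ifs <;> simp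

theorem onQubit_one (j : ι) : onQubit j (1 : Matrix (Fin 2) (Fin 2) ℂ) = 1 := by
  simp only [onQubit, ite_self, tensorOp_one]

/-- A tensor product is linear in its `j`-th factor, so a global scalar can be carried by a single
qubit. -/
theorem onQubit_smul_one (j : ι) (c : ℂ) :
    onQubit j (c • 1 : Matrix (Fin 2) (Fin 2) ℂ) = c • 1 := by
  rw [← onQubit_one j]
  ext x y
  simp only [onQubit, tensorOp, Matrix.of_apply, Matrix.smul_apply, smul_eq_mul]
  -- Split off the factor at `j` on both sides; all the other factors are identities.
  rw [← Finset.mul_prod_erase _ _ (Finset.mem_univ j),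
    ← Finset.mul_prod_erase Finset.univ _ (Finset.mem_univ j), ← mul_assoc]
  congr 1
  · simp
  · exact Finset.prod_congr rfl fun q hq => by rw [if_neg (Finset.ne_of_mem_erase hq),
      if_neg (Finset.ne_of_mem_erase hq)]

theorem onQubit_mem_pauliTensors (j : ι) {P : Matrix (Fin 2) (Fin 2) ℂ} (hP : P ∈ pauliMonoid) :
    onQubit j P ∈ pauliTensors ι := by
  refine ⟨_, fun q => ?_, rfl⟩
  split_ifs
  exacts [hP, one_mem _]

/-- Some qubit is needed to carry the phase: on an empty register the only tensor product is the
identity. -/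
theorem I_smul_one_mem_pauliTensors [Nonempty ι] : (Complex.I • 1 : QOp ι) ∈ pauliTensors ι := by
  obtain ⟨j⟩ := ‹Nonempty ι›
  rw [← onQubit_smul_one j]
  exact onQubit_mem_pauliTensors j I_smul_one_mem

theorem IsPauli.mem_pauliTensors [Nonempty ι] {M : QOp ι} (h : IsPauli M) :
    M ∈ pauliTensors ι := by
  obtain ⟨c, P, hP, rfl⟩ := h
  have h1 : Complex.I ^ c • tensorOp P = (Complex.I • 1) ^ c * tensorOp P := by
    rw [smul_pow, one_pow, smul_mul_assoc, one_mul]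
  rw [h1]
  exact mul_mem (pow_mem I_smul_one_mem_pauliTensors c) ⟨P, fun q => mem_pauliMonoid (hP q), rfl⟩

end

/-! ### Logical Pauli operators of one code block -/

namespace SelfDualCSSCode.SymplecticBasis

variable {n k : ℕ} {Q : SelfDualCSSCode n k} (𝓑 : Q.SymplecticBasis)

/-- Intertwining relations compose, so only the generators of `pauliMonoid` matter: for $X$ and $Z$
the encoder intertwines with the basis operators, and the scalar $i$ commutes with everything. -/
theorem exists_pauliTensors_onQubit [Nonempty (Fin n)] (j : Fin k)
    {P : Matrix (Fin 2) (Fin 2) ℂ} (hP : P ∈ pauliMonoid) :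
    ∃ M ∈ pauliTensors (Fin n), M * 𝓑.encoder = 𝓑.encoder * onQubit j P := by
  induction hP using Submonoid.closure_induction with
  | mem P hP =>
    rcases hP with rfl | rfl | rfl
    · exact ⟨_, (𝓑.X_mem j).1.mem_pauliTensors, 𝓑.isEncoder_encoder.X_intertwine j⟩
    · exact ⟨_, (𝓑.Z_mem j).1.mem_pauliTensors, 𝓑.isEncoder_encoder.Z_intertwine j⟩
    · exact ⟨_, I_smul_one_mem_pauliTensors, by simp [onQubit_smul_one]⟩
  | one => exact ⟨1, one_mem _, by rw [onQubit_one, Matrix.one_mul, Matrix.mul_one]⟩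
  | mul P P' _ _ h h' =>
    obtain ⟨M, hM, e⟩ := h
    obtain ⟨M', hM', e'⟩ := h'
    exact ⟨M * M', mul_mem hM hM', by
      rw [onQubit_mul, Matrix.mul_assoc, e', ← Matrix.mul_assoc, e, Matrix.mul_assoc]⟩

theorem exists_pauliTensors [Nonempty (Fin n)] {U : QOp (Fin k)} (hU : U ∈ pauliTensors (Fin k)) :
    ∃ M ∈ pauliTensors (Fin n), M * 𝓑.encoder = 𝓑.encoder * U := by
  obtain ⟨P, hP, rfl⟩ := hU
  -- Switch on the factors of the logical operator one qubit at a time; `s` is the set of qubits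
  -- already switched on.
  suffices h : ∀ s : Finset (Fin k), ∃ M ∈ pauliTensors (Fin n),
      M * 𝓑.encoder = 𝓑.encoder * tensorOp fun q => if q ∈ s then P q else 1 by
    simpa using h Finset.univ
  intro s
  induction s using Finset.induction_on with
  | empty => exact ⟨1, one_mem _, by simp [tensorOp_one]⟩
  | insert j s hj ih =>
    obtain ⟨M, hM, e⟩ := ih
    obtain ⟨M', hM', e'⟩ := 𝓑.exists_pauliTensors_onQubit j (hP j)
    refine ⟨M' * M, mul_mem hM' hM, ?_⟩
    -- As `j ∉ s`, the old operator is the identity on qubit `j`, so the new factor splits off as a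
    -- one-qubit operator.
    have h : (tensorOp fun q => if q ∈ insert j s then P q else 1) =
        onQubit j (P j) * tensorOp fun q => if q ∈ s then P q else 1 := by
      rw [onQubit, tensorOp_mul]
      congr 1
      funext q
      by_cases hq : q = j
      · subst hq; simp [hj]
      · simp [hq]
    rw [h, Matrix.mul_assoc, e, ← Matrix.mul_assoc, e', Matrix.mul_assoc]

end SelfDualCSSCode.SymplecticBasis

/-! ### Tensor products of maps of blocks -/

section

variable {α β γ ι κ : Type} [Fintype β]

/-- Distributivity: a bit string on all qubits is the same as an independent choice of a bit string
on each block, by currying along `e`. -/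
theorem sum_prod_blocks [Fintype α] [Fintype ι] [DecidableEq α] [DecidableEq β] [DecidableEq ι]
    (e : β × α ≃ ι) (F : β → (α → Fin 2) → ℂ) :
    ∑ z : ι → Fin 2, ∏ b, F b (fun a => z (e (b, a))) = ∏ b, ∑ w, F b w := by
  rw [Finset.prod_univ_sum, Fintype.piFinset_univ]
  exact Fintype.sum_equiv ((e.symm.arrowCongr (Equiv.refl _)).trans (Equiv.curry _ _ _)) _ _
    fun z => rfl

/-- The tensor product of the maps `E` of blocks of qubits. -/
def blockTensor (e : β × α → ι) (f : β × γ → κ)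
    (E : β → Matrix (α → Fin 2) (γ → Fin 2) ℂ) : Matrix (ι → Fin 2) (κ → Fin 2) ℂ :=
  Matrix.of fun x y => ∏ b, E b (fun a => x (e (b, a))) fun c => y (f (b, c))

theorem prod_blocks [Fintype α] [Fintype ι] (e : β × α ≃ ι) (g : ι → ℂ) : ∏ q, g q = ∏ b, ∏ a, g (e (b, a)) := by
  rw [← Fintype.prod_prod_type', ← e.prod_comp]

/-- Mixed-product rule on the output side. The sum over intermediate bit strings runs over `ι`, so
only `e` has to be a bijection; in the mirror rule below it is `f`. -/
theorem tensorOp_mul_blockTensor [Fintype α] [Fintype ι] [DecidableEq α] [DecidableEq β]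
    [DecidableEq ι] (e : β × α ≃ ι) (f : β × γ → κ)
    (E : β → Matrix (α → Fin 2) (γ → Fin 2) ℂ) (G : ι → Matrix (Fin 2) (Fin 2) ℂ) :
    tensorOp G * blockTensor e f E =
      blockTensor e f fun b => tensorOp (fun a => G (e (b, a))) * E b := by
  ext x y
  simp only [Matrix.mul_apply, tensorOp, blockTensor, Matrix.of_apply, prod_blocks e,
    ← Finset.prod_mul_distrib]
  exact sum_prod_blocks e fun b w =>
    (∏ a, G (e (b, a)) (x (e (b, a))) (w a)) * E b w fun c => y (f (b, c))

theorem blockTensor_mul_tensorOp [Fintype γ] [Fintype κ] [DecidableEq β] [DecidableEq γ]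
    [DecidableEq κ] (e : β × α → ι) (f : β × γ ≃ κ)
    (E : β → Matrix (α → Fin 2) (γ → Fin 2) ℂ) (P : κ → Matrix (Fin 2) (Fin 2) ℂ) :
    blockTensor e f E * tensorOp P =
      blockTensor e f fun b => E b * tensorOp fun c => P (f (b, c)) := by
  ext x y
  simp only [Matrix.mul_apply, tensorOp, blockTensor, Matrix.of_apply, prod_blocks f,
    ← Finset.prod_mul_distrib]
  exact sum_prod_blocks f fun b w =>
    E b (fun a => x (e (b, a))) w * ∏ c, P (f (b, c)) (w c) (y (f (b, c)))

end

/-! ### Pauli operators in a concatenated code -/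

namespace ConcatenatedCode

variable {L : ℕ} (𝒞 : ConcatenatedCode L)

/-- A block label omits exactly the `l`-th coordinate of a qubit label, and the position in the
block supplies it. Evaluating at `l` recovers the position, evaluating elsewhere the block. -/
theorem blockInput_bijective (l : Fin L) :
    Function.Bijective fun p : 𝒞.BlockIndex l × Fin (𝒞.n l) => 𝒞.blockInput l p.1 p.2 := by
  constructor
  · rintro ⟨⟨b, b'⟩, a⟩ ⟨⟨d, d'⟩, c⟩ h
    obtain ⟨rfl, h⟩ := Prod.mk.inj h
    have ha : a = c := by simpa using congrFun h ⟨l, le_rfl⟩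
    have hb : b' = d' := by
      funext i
      have hi : i.1 ≠ l := fun h => (Fin.ext_iff.not.1 (Fin.ne_of_gt i.2)) (congrArg Fin.val h)
      simpa [hi] using congrFun h ⟨i.1, i.2.le⟩
    rw [ha, hb]
  · rintro ⟨q, q'⟩
    refine ⟨((q, fun i => q' ⟨i.1, i.2.le⟩), q' ⟨l, le_rfl⟩), Prod.ext rfl ?_⟩
    funext ⟨i, hi⟩
    by_cases h : i = l
    · subst h; simp [blockInput]
    · simp [blockInput, h]

theorem blockOutput_bijective (l : Fin L) :
    Function.Bijective fun p : 𝒞.BlockIndex l × Fin (𝒞.k l) => 𝒞.blockOutput l p.1 p.2 := by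
  constructor
  · rintro ⟨⟨b, b'⟩, a⟩ ⟨⟨d, d'⟩, c⟩ h
    obtain ⟨h, h'⟩ := Prod.mk.inj h
    have ha : a = c := by simpa using congrFun h ⟨l, l.val.lt_succ_self⟩
    have hb : b = d := by
      funext i
      have hi : i.1 ≠ l := fun h => (Fin.ext_iff.not.1 (Fin.ne_of_lt i.2)) (congrArg Fin.val h)
      simpa [hi] using congrFun h ⟨i.1, Nat.lt_succ_of_lt i.2⟩
    have hb' : b' = d' := funext fun i => congrFun h' ⟨i.1, i.2⟩
    rw [ha, hb, hb']
  · rintro ⟨q, q'⟩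
    refine ⟨((fun i => q ⟨i.1, Nat.lt_succ_of_lt i.2⟩, fun i => q' ⟨i.1, i.2⟩),
      q ⟨l, l.val.lt_succ_self⟩), Prod.ext ?_ rfl⟩
    funext ⟨i, hi⟩
    by_cases h : i = l
    · subst h; simp [blockOutput]
    · simp [blockOutput, h]

/-- From $n = 2\,\mathrm{rank}\,H + k$ and $k\ge 1$. This supplies the qubit that carries the phase.
-/
theorem nonempty_physical (l : Fin L) : Nonempty (Fin (𝒞.n l)) :=
  ⟨⟨0, by have := (𝒞.code l).rank_eq; have := 𝒞.one_le_k l; omega⟩⟩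

theorem exists_pauliTensors_stepEncoder (l : Fin L) {U : QOp (𝒞.LevelIndex (l.val + 1))}
    (hU : U ∈ pauliTensors (𝒞.LevelIndex (l.val + 1))) :
    ∃ M ∈ pauliTensors (𝒞.LevelIndex l.val), M * 𝒞.stepEncoder l = 𝒞.stepEncoder l * U := by
  obtain ⟨P, hP, rfl⟩ := hU
  have := 𝒞.nonempty_physical l
  let e := Equiv.ofBijective _ (𝒞.blockInput_bijective l)
  let f := Equiv.ofBijective _ (𝒞.blockOutput_bijective l)
  -- The gate may restrict differently to different blocks, so the physical factors are chosen block
  -- by block.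
  have hblock : ∀ b, ∃ G : Fin (𝒞.n l) → Matrix (Fin 2) (Fin 2) ℂ, (∀ a, G a ∈ pauliMonoid) ∧
      tensorOp G * (𝒞.basis l).encoder =
        (𝒞.basis l).encoder * tensorOp fun c => P (f (b, c)) := by
    intro b
    obtain ⟨_, ⟨G, hG, rfl⟩, h⟩ :=
      (𝒞.basis l).exists_pauliTensors ⟨fun c => P (f (b, c)), fun c => hP _, rfl⟩
    exact ⟨G, hG, h⟩
  choose G hG hGP using hblock
  -- Glue the choices: `e.symm q` is the block of `q` together with its position there.
  refine ⟨_, ⟨fun q => G (e.symm q).1 (e.symm q).2, fun q => hG _ _, rfl⟩, ?_⟩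
  have hstep : 𝒞.stepEncoder l = blockTensor e f fun _ => (𝒞.basis l).encoder := rfl
  rw [hstep, tensorOp_mul_blockTensor, blockTensor_mul_tensorOp]
  simp only [Equiv.symm_apply_apply, hGP]

theorem levelEncoder_self {m : ℕ} (hm : m ≤ L) : 𝒞.levelEncoder le_rfl hm = 1 := by
  rw [levelEncoder, Nat.leRec_self]

theorem levelEncoder_succ {m l : ℕ} (hml : m ≤ l) (hl : l + 1 ≤ L) :
    𝒞.levelEncoder (Nat.le_succ_of_le hml) hl =
      𝒞.levelEncoder hml (Nat.le_of_succ_le hl) * 𝒞.stepEncoder ⟨l, hl⟩ := by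
  rw [levelEncoder, Nat.leRec_succ _ _ hml]
  rfl

theorem exists_pauliTensors_levelEncoder {m l : ℕ} (hml : m ≤ l) (hl : l ≤ L)
    {U : QOp (𝒞.LevelIndex l)} (hU : U ∈ pauliTensors (𝒞.LevelIndex l)) :
    ∃ M ∈ pauliTensors (𝒞.LevelIndex m),
      M * 𝒞.levelEncoder hml hl = 𝒞.levelEncoder hml hl * U := by
  induction l, hml using Nat.le_induction with
  | base => exact ⟨U, hU, by rw [levelEncoder_self, mul_one, one_mul]⟩
  | succ l hml ih =>
    -- The gate first passes through the outermost code, then through the remaining levels by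
    -- induction: with $E$ the encoder from level `l` and $S$ the last step, $ESU = EMS = M'ES$.
    obtain ⟨M, hM, h⟩ := 𝒞.exists_pauliTensors_stepEncoder ⟨l, hl⟩ hU
    obtain ⟨M', hM', h'⟩ := ih (Nat.le_of_succ_le hl) hM
    refine ⟨M', hM', ?_⟩
    rw [levelEncoder_succ 𝒞 hml hl, Matrix.mul_assoc, ← h, ← Matrix.mul_assoc, h',
      Matrix.mul_assoc]

end ConcatenatedCode

theorem theorem2 (L : ℕ) (𝒞 : ConcatenatedCode L) (h𝒞 : ∀ i, (𝒞.basis i).IsCompatible)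
    (l : ℕ) (hl : l ≤ L)
    (B : ∀ i : {i : Fin L // i.val < l}, Set (Fin (𝒞.k i)))
    (A : ∀ i : {i : Fin L // l ≤ i.val}, Set (Fin (𝒞.n i)))
    (U : QOp (𝒞.LevelIndex l)) (hU : 𝒞.IsPauliTypeGate B A U) (m : ℕ) (hml : m ≤ l) :
    𝒞.IsTransversalAt hml hl U := by
  obtain ⟨P, hP, hP1, rfl⟩ := hU
  -- All that is kept of the product set is that each factor is a Pauli matrix inside it and the
  -- identity outside.
  have hmem : ∀ q, P q ∈ pauliMonoid := fun q =>
    mem_pauliMonoid ((em _).elim (fun h => Or.inr (hP q h)) fun h => Or.inl (hP1 q h))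
  obtain ⟨_, ⟨G, hG, rfl⟩, h⟩ := 𝒞.exists_pauliTensors_levelEncoder hml hl ⟨P, hmem, rfl⟩
  exact ⟨G, fun q => pauliMonoid_le_unitaryGroup (hG q), h⟩
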